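/- **Theorem (multidimensional Berry–Esseen bound for unions of orthants).** For an $\mathbb R^d$-valued random vector $Y$ write $\|Y\|_p=\mathbf E[|Y|^p]^{1/p}$, where $|\cdot|$ is the Euclidean length. For $0<\eta<1$, call $Y$ *$\eta$-HC* if $\|Y\|_4<\infty$ and $\|a+\eta Y\|_4\le\|a+Y\|_2$ for all $a\in\mathbb R^d$. Let $\mathrm{sgn}(t)=1$ for $t\ge 0$ and $\mathrm{sgn}(t)=-1$ for $t<0$, and apply $\mathrm{sgn}$ to vectors coordinatewise. A set $A\subseteq\mathbb R^d$ is a *translate of a union of orthants* if there is $\Theta\in\mathbb R^d$ such that whether $x\in A$ depends only on $\mathrm{sgn}(x-\Theta)\in\{-1,1\}^d$. There is an absolute constant $C$ such that the following holds for all $d,n$ and $0<\eta<1$. Let $X_1,\dots,X_n$ be independent (not necessarily identically distributed) $\eta$-HC random vectors in $\mathbb R^d$ with $\mathbf E[X_j]=0$ for all $j$, let $S=X_1+\cdots+X_n$, and suppose that the covariance matrix $M=\mathrm{Cov}[S]$ satisfies $M_{ii}=1$ for all $i$ (equivalently $\sum_{j}\mathbf E[X_j[i]^2]=1$ for all $i$).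 Put $\sigma_j=\|X_j\|_2$. Let $G_1,\dots,G_n$ be independent mean-zero Gaussian random vectors in $\mathbb R^d$ with $\mathrm{Cov}[G_j]=\mathrm{Cov}[X_j]$ for each $j$, and let $G=G_1+\cdots+G_n$. The covariance matrices are allowed to be singular. Then for every translate $A$ of a union of orthants, $$\bigl|\Pr[S\in A]-\Pr[G\in A]\bigr|\le C\,\eta^{-1/2}\,d^{13/8}\Bigl(\sum_{j=1}^n\sigma_j^4\Bigr)^{1/8}.$$ -/

import Mathlib

open MeasureTheory ProbabilityTheory
open scoped ENNReal

namespace MultiBE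

/-- An `ℝ^d`-valued random vector `X` is `η`-HC (`η`-hypercontractive), for `0 < η < 1`, if
`‖X‖₄ < ∞` and `‖a + η X‖₄ ≤ ‖a + X‖₂` for every `a ∈ ℝ^d`, where
`‖Y‖_p = (E |Y|^p)^(1/p)` and `|·|` is the Euclidean length. -/
def IsHC {Ω : Type*} [MeasurableSpace Ω] {d : ℕ} (μ : Measure Ω) (η : ℝ)
    (X : Ω → EuclideanSpace ℝ (Fin d)) : Prop :=
  0 < η ∧ η < 1 ∧ MemLp X 4 μ ∧
    ∀ a : EuclideanSpace ℝ (Fin d),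
      eLpNorm (fun ω => a + η • X ω) 4 μ ≤ eLpNorm (fun ω => a + X ω) 2 μ

/-- The covariance matrix of a random vector. -/
noncomputable def covMatrix {Ω : Type*} [MeasurableSpace Ω] {d : ℕ} (μ : Measure Ω)
    (X : Ω → EuclideanSpace ℝ (Fin d)) : Matrix (Fin d) (Fin d) ℝ :=
  Matrix.of fun i k => cov[fun ω => X ω i, fun ω => X ω k; μ]

/-- The sign function with values in `{-1, 1}` and the convention `sgn 0 = 1`. -/
noncomputable def sgn (x : ℝ) : ℤ := if 0 ≤ x then 1 else -1

/-- The coordinatewise sign vector. -/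
noncomputable def vecSgn {d : ℕ} (x : EuclideanSpace ℝ (Fin d)) : Fin d → ℤ :=
  fun i => sgn (x i)

/-- `A` is a translate of a union of orthants: for some `θ`, membership of `x` in `A` depends
only on the sign vector of `x - θ`. -/
def IsTranslateUnionOrthants {d : ℕ} (A : Set (EuclideanSpace ℝ (Fin d))) : Prop :=
  ∃ θ : EuclideanSpace ℝ (Fin d), ∀ x y : EuclideanSpace ℝ (Fin d),
    vecSgn (x - θ) = vecSgn (y - θ) → (x ∈ A ↔ y ∈ A)

end MultiBE

namespace MultiBE

/-! The proof combines smoothing with Lindeberg replacement. The indicator of `A` is a sum, over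
sign patterns, of products of half-line indicators. Replacing these by `σ (r (x - θ))` and `1 - σ (r
(x - θ))`, with `σ` the sigmoid, gives a smooth function whose partial derivatives of order `k ≤ 3`
are at most `r ^ k`. The `2 ^ d` orthants cost nothing, because the sum over patterns factors over
coordinates (`abs_smoothOrthants_le`). The Taylor remainder is therefore at most `d ^ (3/2) r³
|h|³`, and Lindeberg's exchange (`abs_integral_map_sum_sub_le`) costs that constant times the sum
`Δ` of the third moments of all `X j` and `G j`.

The smoothing error is at most a sum over coordinates of `bump`, a multiple of `σ'`. This majorant
is smooth too, so its mean under `S` is compared with its mean under `G` by the same exchange. There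
the marginals are standard normal and the mean is at most `2 / r`. Thus no anticoncentration of `S`
and no invertibility of the covariance is needed (`abs_measureReal_sub_le`).

Hypercontractivity bounds third moments by `η⁻² σ_j³`, and `∑ σ_j³ ≤ √(∑ σ_j²) √(∑ σ_j⁴)` with `∑
σ_j² = d`. It remains to choose `r` (`smoothing_bound_le`). -/

/-- A function on `ℝ^d` with a second-order Taylor expansion at every point, whose remainder is
bounded by `K |h|³`. -/
def HasCubicExpansion {d : ℕ} (f : EuclideanSpace ℝ (Fin d) → ℝ) (K : ℝ) : Prop :=
  ∀ x, ∃ (a : Fin d → ℝ) (b : Fin d → Fin d → ℝ), ∀ h,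
    |f (x + h) - f x - ∑ i, a i * h i - ∑ i, ∑ k, b i k * (h i * h k)| ≤ K * ‖h‖ ^ 3

/-! ### Taylor's formula on the unit interval -/

lemma abs_sub_le_of_hasDerivAt_le {g g' : ℝ → ℝ} {M : ℝ} (hg : ∀ t, HasDerivAt g (g' t) t)
    (hM : ∀ t ∈ Set.Icc (0 : ℝ) 1, |g' t| ≤ M) {t : ℝ} (ht : t ∈ Set.Icc (0 : ℝ) 1) :
    |g t - g 0| ≤ M := by
  have h := (convex_Icc (0 : ℝ) 1).norm_image_sub_le_of_norm_hasDerivWithin_le (f := g) (f' := g')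
    (C := M) (fun x _ => (hg x).hasDerivWithinAt) hM (Set.left_mem_Icc.2 zero_le_one) ht
  have hM0 : 0 ≤ M := (abs_nonneg _).trans (hM t ht)
  rw [Real.norm_eq_abs, Real.norm_eq_abs, sub_zero, abs_of_nonneg ht.1] at h
  nlinarith [ht.2]

/-- The mean value inequality is applied three times, each time after subtracting the Taylor
polynomial. The sharp factor 1/6 is given up, which only affects the absolute constant. -/
lemma abs_taylor_two_le {g g₁ g₂ g₃ : ℝ → ℝ} {M : ℝ} (h₁ : ∀ t, HasDerivAt g (g₁ t) t)
    (h₂ : ∀ t, HasDerivAt g₁ (g₂ t) t) (h₃ : ∀ t, HasDerivAt g₂ (g₃ t) t)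
    (hM : ∀ t, |g₃ t| ≤ M) : |g 1 - g 0 - g₁ 0 - g₂ 0 / 2| ≤ M := by
  have e₂ : ∀ t ∈ Set.Icc (0 : ℝ) 1, |g₂ t - g₂ 0| ≤ M := fun t ht =>
    abs_sub_le_of_hasDerivAt_le h₃ (fun s _ => hM s) ht
  have e₁ : ∀ t ∈ Set.Icc (0 : ℝ) 1, |g₁ t - g₁ 0 - t * g₂ 0| ≤ M := fun t ht => by
    have := abs_sub_le_of_hasDerivAt_le (g := fun t => g₁ t - t * g₂ 0)
      (g' := fun t => g₂ t - 1 * g₂ 0)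
      (fun t => (h₂ t).sub ((hasDerivAt_id t).mul_const _)) (by simpa using e₂) ht
    convert this using 2
    ring
  have := abs_sub_le_of_hasDerivAt_le (g := fun t => g t - t * g₁ 0 - t ^ 2 * (g₂ 0 / 2))
    (g' := fun t => g₁ t - 1 * g₁ 0 - (((2 : ℕ) : ℝ) * t ^ (2 - 1)) * (g₂ 0 / 2))
    (fun t => ((h₁ t).sub ((hasDerivAt_id t).mul_const _)).sub
      ((hasDerivAt_pow 2 t).mul_const _)) (fun t ht => by
        convert e₁ t ht using 2
        norm_num
        ring) (Set.right_mem_Icc.2 zero_le_one)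
  convert this using 2
  ring

/-! ### Smoothed half-line indicators -/

open Polynomial in
/-- The `k`-th derivative of `σ` (for `true`) and of `1 - σ` (for `false`) as a polynomial in the
sigmoid function `σ`. -/
noncomputable def sigmoidPoly (s : Bool) : ℕ → ℝ[X]
  | 0 => if s then X else 1 - X
  | k + 1 => derivative (sigmoidPoly s k) * (X - X ^ 2)

/-- The `k`-th derivative of `x ↦ σ (r (x - θ))`, respectively of `x ↦ 1 - σ (r (x - θ))`. -/
noncomputable def smoothSign (r θ : ℝ) (s : Bool) (k : ℕ) (x : ℝ) : ℝ :=
  r ^ k * (sigmoidPoly s k).eval (Real.sigmoid (r * (x - θ)))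

lemma hasDerivAt_smoothSign (r θ : ℝ) (s : Bool) (k : ℕ) (x : ℝ) :
    HasDerivAt (smoothSign r θ s k) (smoothSign r θ s (k + 1) x) x := by
  have h1 : HasDerivAt (fun x : ℝ => r * (x - θ)) r x := by
    simpa using ((hasDerivAt_id x).sub_const θ).const_mul r
  have h2 := ((((sigmoidPoly s k).hasDerivAt _).comp x
    ((Real.hasDerivAt_sigmoid (r * (x - θ))).comp x h1))).const_mul (r ^ k)
  refine h2.congr_deriv ?_
  simp only [smoothSign, sigmoidPoly, Function.comp_apply, Polynomial.eval_mul,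
    Polynomial.eval_sub, Polynomial.eval_pow, Polynomial.eval_X]
  ring

lemma continuous_smoothSign (r θ : ℝ) (s : Bool) (k : ℕ) : Continuous (smoothSign r θ s k) :=
  continuous_iff_continuousAt.2 fun x => (hasDerivAt_smoothSign r θ s k x).continuousAt

lemma smoothSign_zero_nonneg (r θ : ℝ) (s : Bool) (x : ℝ) : 0 ≤ smoothSign r θ s 0 x := by
  cases s <;>
    simp [smoothSign, sigmoidPoly, Real.sigmoid_nonneg, Real.sigmoid_le_one]

lemma smoothSign_zero_true (r θ x : ℝ) :
    smoothSign r θ true 0 x = Real.sigmoid (r * (x - θ)) := by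
  simp [smoothSign, sigmoidPoly]

lemma smoothSign_zero_false (r θ x : ℝ) :
    smoothSign r θ false 0 x = 1 - Real.sigmoid (r * (x - θ)) := by
  simp [smoothSign, sigmoidPoly]

/-- The bound must be exactly 1, since it is later raised to the power `d`. Order 4 is needed
because `bump` is already a first derivative and is expanded to third order. -/
lemma abs_eval_sigmoidPoly_add_le {k : ℕ} (hk : k ≤ 4) {p : ℝ} (h0 : 0 ≤ p) (h1 : p ≤ 1) :
    |(sigmoidPoly true k).eval p| + |(sigmoidPoly false k).eval p| ≤ 1 := by
  have hu : 0 ≤ p * (1 - p) := mul_nonneg h0 (by linarith)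
  have hu' : p * (1 - p) ≤ 1 / 4 := by nlinarith [sq_nonneg (p - 1 / 2)]
  have hp : |1 - 2 * p| ≤ 1 := abs_le.2 ⟨by linarith, by linarith⟩
  -- Each derivative of order 1 to 4 is `p (1 - p)` times a factor in `[-1, 1]` and a factor in
  -- `[-2, 2]`, and the two signs give opposite values: the sum is at most `2 · (1/4) · 2 = 1`.
  have key : ∀ a b c e : ℝ, |c| ≤ 1 → |e| ≤ 2 → a = p * (1 - p) * c * e → b = -a →
      |a| + |b| ≤ 1 := by
    rintro a b c e hc he rfl rfl
    rw [abs_neg, abs_mul, abs_mul, abs_of_nonneg hu]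
    have : |c| * |e| ≤ 1 * 2 := mul_le_mul hc he (abs_nonneg _) zero_le_one
    nlinarith [abs_nonneg c, abs_nonneg e, mul_nonneg (abs_nonneg c) (abs_nonneg e)]
  interval_cases k
  · simp [sigmoidPoly, abs_of_nonneg h0, abs_of_nonneg (sub_nonneg.2 h1)]
  · refine key _ _ 1 1 (by norm_num) (by norm_num) ?_ ?_ <;> (simp [sigmoidPoly]; try ring)
  · refine key _ _ (1 - 2 * p) 1 hp (by norm_num) ?_ ?_ <;> simp [sigmoidPoly] <;> ring
  · refine key _ _ 1 (1 - 6 * (p * (1 - p))) (by norm_num)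
      (abs_le.2 ⟨by linarith, by linarith⟩) ?_ ?_ <;> simp [sigmoidPoly] <;> ring
  · refine key _ _ (1 - 2 * p) (1 - 12 * (p * (1 - p))) hp
      (abs_le.2 ⟨by linarith, by linarith⟩) ?_ ?_ <;> simp [sigmoidPoly] <;> ring

lemma sum_abs_smoothSign_le {r : ℝ} (hr : 0 ≤ r) (θ : ℝ) {k : ℕ} (hk : k ≤ 4) (x : ℝ) :
    ∑ s, |smoothSign r θ s k x| ≤ r ^ k := by
  simp only [Fintype.sum_bool, smoothSign, abs_mul, abs_of_nonneg (pow_nonneg hr k), ← mul_add]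
  exact mul_le_of_le_one_right (pow_nonneg hr k)
    (abs_eval_sigmoidPoly_add_le hk (Real.sigmoid_nonneg _) (Real.sigmoid_le_one _))

lemma abs_smoothSign_le {r : ℝ} (hr : 0 ≤ r) (θ : ℝ) (s : Bool) {k : ℕ} (hk : k ≤ 4) (x : ℝ) :
    |smoothSign r θ s k x| ≤ r ^ k :=
  (Finset.single_le_sum (f := fun s => |smoothSign r θ s k x|) (fun _ _ => abs_nonneg _)
    (Finset.mem_univ s)).trans (sum_abs_smoothSign_le hr θ hk x)

/-! ### Smoothed unions of orthants -/

section
variable {d : ℕ}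

/-- The partial derivative of multi-index `α` of the smoothed sum of orthant indicators
with coefficients `c`. -/
noncomputable def smoothOrthants (r : ℝ) (θ : EuclideanSpace ℝ (Fin d)) (c : (Fin d → Bool) → ℝ)
    (α : Fin d → ℕ) (x : EuclideanSpace ℝ (Fin d)) : ℝ :=
  ∑ s : Fin d → Bool, c s * ∏ l, smoothSign r (θ l) (s l) (α l) (x l)

lemma hasDerivAt_smoothSign_line (r θ : ℝ) (s : Bool) (k : ℕ) (y h t : ℝ) :
    HasDerivAt (fun t => smoothSign r θ s k (y + t * h))
      (h * smoothSign r θ s (k + 1) (y + t * h)) t := by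
  have h1 : HasDerivAt (fun t : ℝ => y + t * h) h t := by
    simpa using ((hasDerivAt_id t).mul_const h).const_add y
  exact ((hasDerivAt_smoothSign r θ s k (y + t * h)).comp t h1).congr_deriv (mul_comm _ _)

/-- By the product rule, differentiating factor `i` raises `α i` by one. The family is closed under
differentiation, so one bound serves all orders. -/
lemma hasDerivAt_smoothOrthants (r : ℝ) (θ : EuclideanSpace ℝ (Fin d)) (c : (Fin d → Bool) → ℝ)
    (α : Fin d → ℕ) (x h : EuclideanSpace ℝ (Fin d)) (t : ℝ) :
    HasDerivAt (fun t : ℝ => smoothOrthants r θ c α (x + t • h))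
      (∑ i, h i * smoothOrthants r θ c (α + Pi.single i 1) (x + t • h)) t := by
  have h1 : ∀ s : Fin d → Bool, HasDerivAt
      (fun t : ℝ => c s * ∏ l, smoothSign r (θ l) (s l) (α l) (x l + t * h l))
      (c s * ∑ i, (∏ l ∈ Finset.univ.erase i, smoothSign r (θ l) (s l) (α l) (x l + t * h l)) •
        (h i * smoothSign r (θ i) (s i) (α i + 1) (x i + t * h i))) t := fun s =>
    (HasDerivAt.fun_finsetProd fun l _ =>
      hasDerivAt_smoothSign_line r (θ l) (s l) (α l) (x l) (h l) t).const_mul _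
  have h2 := HasDerivAt.fun_sum (u := Finset.univ) fun s _ => h1 s
  simp only [smoothOrthants, PiLp.add_apply, PiLp.smul_apply, smul_eq_mul]
  refine h2.congr_deriv ?_
  simp only [Finset.mul_sum]
  rw [Finset.sum_comm]
  refine Finset.sum_congr rfl fun i _ => Finset.sum_congr rfl fun s _ => ?_
  rw [← Finset.mul_prod_erase _ _ (Finset.mem_univ i)]
  have : ∏ l ∈ Finset.univ.erase i,
      smoothSign r (θ l) (s l) ((α + Pi.single i 1 : Fin d → ℕ) l) (x l + t * h l) =
      ∏ l ∈ Finset.univ.erase i, smoothSign r (θ l) (s l) (α l) (x l + t * h l) :=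
    Finset.prod_congr rfl fun l hl => by simp [Finset.ne_of_mem_erase hl]
  rw [this]
  simp only [Pi.add_apply, Pi.single_eq_same, smul_eq_mul]
  ring

/-- Once the coefficients are bounded by 1, the sum over all patterns of a product is the product
over coordinates of two-term sums, each at most `r ^ α l`. -/
lemma abs_smoothOrthants_le {r : ℝ} (hr : 0 ≤ r) (θ : EuclideanSpace ℝ (Fin d))
    {c : (Fin d → Bool) → ℝ} (hc : ∀ s, |c s| ≤ 1) {α : Fin d → ℕ} (hα : ∀ l, α l ≤ 4)
    (x : EuclideanSpace ℝ (Fin d)) : |smoothOrthants r θ c α x| ≤ r ^ ∑ l, α l := by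
  calc |smoothOrthants r θ c α x|
      ≤ ∑ s : Fin d → Bool, |c s * ∏ l, smoothSign r (θ l) (s l) (α l) (x l)| :=
        Finset.abs_sum_le_sum_abs _ _
    _ ≤ ∑ s : Fin d → Bool, ∏ l, |smoothSign r (θ l) (s l) (α l) (x l)| := by
        refine Finset.sum_le_sum fun s _ => ?_
        rw [abs_mul, Finset.abs_prod]
        exact mul_le_of_le_one_left (Finset.prod_nonneg fun _ _ => abs_nonneg _) (hc s)
    _ = ∏ l, ∑ s, |smoothSign r (θ l) s (α l) (x l)| := by
        rw [Finset.prod_univ_sum, Fintype.piFinset_univ]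
    _ ≤ ∏ l, r ^ α l := Finset.prod_le_prod (fun l _ => Finset.sum_nonneg fun _ _ => abs_nonneg _)
        fun l _ => sum_abs_smoothSign_le hr _ (hα l) _
    _ = r ^ ∑ l, α l := Finset.prod_pow_eq_pow_sum _ _ _

lemma continuous_smoothOrthants (r : ℝ) (θ : EuclideanSpace ℝ (Fin d)) (c : (Fin d → Bool) → ℝ)
    (α : Fin d → ℕ) : Continuous (smoothOrthants r θ c α) := by
  unfold smoothOrthants
  refine continuous_finsetSum _ fun s _ => continuous_const.mul <|
    continuous_finsetProd _ fun l _ => (continuous_smoothSign _ _ _ _).comp ?_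
  fun_prop

lemma sum_abs_cube_le (h : EuclideanSpace ℝ (Fin d)) :
    (∑ i, |h i|) ^ 3 ≤ (d : ℝ) ^ (3 / 2 : ℝ) * ‖h‖ ^ 3 := by
  have h1 : (∑ i, |h i|) ^ 2 ≤ d * ‖h‖ ^ 2 := by
    have := sq_sum_le_card_mul_sum_sq (s := Finset.univ) (f := fun i => |h i|)
    simpa [EuclideanSpace.real_norm_sq_eq] using this
  have h2 : ∑ i, |h i| ≤ √d * ‖h‖ := by
    refine abs_le_of_sq_le_sq' ?_ (by positivity) |>.2
    rwa [mul_pow, Real.sq_sqrt (Nat.cast_nonneg d)]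
  calc (∑ i, |h i|) ^ 3 ≤ (√d * ‖h‖) ^ 3 :=
        pow_le_pow_left₀ (Finset.sum_nonneg fun _ _ => abs_nonneg _) h2 3
    _ = _ := by
        rw [mul_pow, Real.sqrt_eq_rpow, ← Real.rpow_natCast (_ ^ _), ← Real.rpow_mul (by simp)]
        norm_num

/-- Along `t ↦ x + t • h` the third derivative is at most `r³ (∑ |h i|)³`; Cauchy–Schwarz turns the
`ℓ¹` norm into `√d ‖h‖`. -/
lemma hasCubicExpansion_smoothOrthants {r : ℝ} (hr : 0 ≤ r) (θ : EuclideanSpace ℝ (Fin d))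
    {c : (Fin d → Bool) → ℝ} (hc : ∀ s, |c s| ≤ 1) :
    HasCubicExpansion (smoothOrthants r θ c 0) (d ^ (3 / 2 : ℝ) * r ^ 3) := by
  intro x
  let e : Fin d → Fin d → ℕ := fun i => Pi.single i 1
  refine ⟨fun i => smoothOrthants r θ c (0 + e i) x,
    fun i k => smoothOrthants r θ c (0 + e i + e k) x / 2, fun h => ?_⟩
  have hd := fun α t => hasDerivAt_smoothOrthants r θ c α x h t
  have h3 : ∀ t : ℝ, |∑ i, h i * ∑ k, h k * ∑ l, h l *
      smoothOrthants r θ c (0 + e i + e k + e l) (x + t • h)| ≤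
      (d : ℝ) ^ (3 / 2 : ℝ) * r ^ 3 * ‖h‖ ^ 3 := fun t => by
    have hb : ∀ i k l, |smoothOrthants r θ c (0 + e i + e k + e l) (x + t • h)| ≤ r ^ 3 := by
      intro i k l
      refine (abs_smoothOrthants_le hr θ hc (fun m => ?_) _).trans_eq ?_
      · simp only [e, Pi.add_apply, Pi.zero_apply, Pi.single_apply]
        split_ifs <;> norm_num
      · simp [e, Finset.sum_add_distrib]
    have step : ∀ (u : Fin d → ℝ) (B : ℝ), (∀ i, |u i| ≤ B) →
        |∑ i, h i * u i| ≤ (∑ i, |h i|) * B := fun u B hu =>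
      (Finset.abs_sum_le_sum_abs _ _).trans <| by
        rw [Finset.sum_mul]
        refine Finset.sum_le_sum fun i _ => ?_
        rw [abs_mul]
        exact mul_le_mul_of_nonneg_left (hu i) (abs_nonneg _)
    refine (step _ _ fun i => step _ _ fun k => step _ _ fun l => hb i k l).trans ?_
    have := mul_le_mul_of_nonneg_right (sum_abs_cube_le h) (pow_nonneg hr 3)
    linarith
  have := abs_taylor_two_le (fun t => hd 0 t)
    (fun t => HasDerivAt.fun_sum (u := Finset.univ) fun i _ => (hd (0 + e i) t).const_mul (h i))
    (fun t => HasDerivAt.fun_sum (u := Finset.univ) fun i _ =>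
      (HasDerivAt.fun_sum (u := Finset.univ) fun k _ =>
        (hd (0 + e i + e k) t).const_mul (h k)).const_mul (h i)) h3
  refine le_trans (le_of_eq ?_) this
  simp only [one_smul, zero_smul, add_zero]
  congr 2
  · congr 1
    exact Finset.sum_congr rfl fun i _ => mul_comm _ _
  · rw [Finset.sum_div]
    refine Finset.sum_congr rfl fun i _ => ?_
    rw [Finset.mul_sum, Finset.sum_div]
    refine Finset.sum_congr rfl fun k _ => ?_
    ring

/-! ### The majorant of the smoothing error -/

/-- Twice the derivative of the sigmoid function, a smooth majorant of the smoothing error. -/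
noncomputable def bump (r θ : ℝ) (x : ℝ) : ℝ :=
  2 * (Real.sigmoid (r * (x - θ)) * (1 - Real.sigmoid (r * (x - θ))))

lemma bump_nonneg (r θ x : ℝ) : 0 ≤ bump r θ x :=
  mul_nonneg zero_le_two (mul_nonneg (Real.sigmoid_nonneg _) (sub_nonneg.2 (Real.sigmoid_le_one _)))

lemma bump_le_one (r θ x : ℝ) : bump r θ x ≤ 1 := by
  unfold bump
  nlinarith [sq_nonneg (Real.sigmoid (r * (x - θ)) - 1 / 2)]

lemma continuous_bump (r θ : ℝ) : Continuous (bump r θ) := by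
  unfold bump
  have : Continuous fun x => Real.sigmoid (r * (x - θ)) :=
    continuous_sigmoid.comp (by fun_prop)
  fun_prop

lemma bump_eq {r : ℝ} (hr : 0 < r) (θ x : ℝ) :
    bump r θ x = 2 / r * smoothSign r θ true 1 x := by
  simp only [bump, smoothSign, sigmoidPoly]
  simp
  field_simp

/-- Only one coordinate matters, so no power of `d` appears. The constant is `(2 / r) · r ^ 4`. -/
lemma hasCubicExpansion_bump {r : ℝ} (hr : 0 < r) (θ : ℝ) (i : Fin d) :
    HasCubicExpansion (fun x : EuclideanSpace ℝ (Fin d) => bump r θ (x i)) (2 * r ^ 3) := by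
  intro x
  refine ⟨fun j => if j = i then 2 / r * smoothSign r θ true 2 (x i) else 0,
    fun j k => if j = i then if k = i then 2 / r * smoothSign r θ true 3 (x i) / 2 else 0 else 0,
    fun h => ?_⟩
  have hd := fun k t => hasDerivAt_smoothSign_line r θ true k (x i) (h i) t
  have := abs_taylor_two_le (M := 2 * r ^ 3 * ‖h‖ ^ 3) (fun t => (hd 1 t).const_mul (2 / r))
    (fun t => ((hd 2 t).const_mul (h i)).const_mul (2 / r))
    (fun t => (((hd 3 t).const_mul (h i)).const_mul (h i)).const_mul (2 / r)) (fun t => by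
      have h1 := abs_smoothSign_le hr.le θ true (le_refl 4) (x i + t * h i)
      have h2 : |h i| ≤ ‖h‖ := PiLp.norm_apply_le h i
      have h3 : |h i| ^ 3 ≤ ‖h‖ ^ 3 := pow_le_pow_left₀ (abs_nonneg _) h2 3
      rw [abs_mul, abs_mul, abs_mul, abs_mul, abs_of_pos (div_pos two_pos hr)]
      calc 2 / r * (|h i| * (|h i| * (|h i| * |smoothSign r θ true (3 + 1) (x i + t * h i)|)))
          = 2 / r * (|h i| ^ 3 * |smoothSign r θ true 4 (x i + t * h i)|) := by ring
        _ ≤ 2 / r * (‖h‖ ^ 3 * r ^ 4) := by gcongr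
        _ = _ := by field_simp)
  refine le_trans (le_of_eq ?_) this
  simp only [bump_eq hr, PiLp.add_apply]
  simp
  congr 1
  ring

/-! ### Lindeberg replacement -/

/-- If `f` is bounded and continuous with a cubic expansion, then replacing a convolution factor
by another one with the same first and second moments changes the integral of `f` by third
moments only. -/
lemma abs_integral_conv_sub_le {f : EuclideanSpace ℝ (Fin d) → ℝ} {K B : ℝ}
    (hf : HasCubicExpansion f K) (hfc : Continuous f) (hfB : ∀ x, |f x| ≤ B)
    (ρ m g : Measure (EuclideanSpace ℝ (Fin d)))
    [IsProbabilityMeasure ρ] [IsProbabilityMeasure m] [IsProbabilityMeasure g]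
    (hm : MemLp id 3 m) (hg : MemLp id 3 g)
    (h1 : ∀ i, ∫ h, h i ∂m = ∫ h, h i ∂g)
    (h2 : ∀ i k, ∫ h, h i * h k ∂m = ∫ h, h i * h k ∂g) :
    |∫ x, f x ∂(ρ ∗ m) - ∫ x, f x ∂(ρ ∗ g)| ≤
      K * (∫ h, ‖h‖ ^ 3 ∂m + ∫ h, ‖h‖ ^ 3 ∂g) := by
  have hint : ∀ τ : Measure (EuclideanSpace ℝ (Fin d)), IsProbabilityMeasure τ → Integrable f τ :=
    fun τ _ => Integrable.of_bound hfc.aestronglyMeasurable B (.of_forall hfB)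
  have hshift : ∀ τ : Measure (EuclideanSpace ℝ (Fin d)), IsProbabilityMeasure τ → ∀ x,
      Integrable (fun h => f (x + h)) τ := fun τ _ x =>
    Integrable.of_bound (by fun_prop) B (.of_forall fun h => hfB _)
  have hout : ∀ τ : Measure (EuclideanSpace ℝ (Fin d)), IsProbabilityMeasure τ →
      Integrable (fun x => ∫ h, f (x + h) ∂τ) ρ := fun τ _ => by
    have : Integrable (fun p : _ × _ => f (p.1 + p.2)) (ρ.prod τ) :=
      Integrable.of_bound (by fun_prop) B (.of_forall fun h => hfB _)
    exact this.integral_prod_left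
  rw [integral_conv (hint _ inferInstance), integral_conv (hint _ inferInstance),
    ← integral_sub (hout m inferInstance) (hout g inferInstance)]
  have hpt : ∀ x, |∫ h, f (x + h) ∂m - ∫ h, f (x + h) ∂g| ≤
      K * (∫ h, ‖h‖ ^ 3 ∂m + ∫ h, ‖h‖ ^ 3 ∂g) := by
    intro x
    obtain ⟨a, b, hab⟩ := hf x
    -- The integral of the quadratic Taylor polynomial involves only moments of order at most two,
    -- so it is the same for `m` and `g`.
    have key : ∀ τ : Measure (EuclideanSpace ℝ (Fin d)), IsProbabilityMeasure τ → MemLp id 3 τ →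
        |∫ h, f (x + h) ∂τ - (f x + ∑ i, a i * ∫ h, h i ∂τ +
          ∑ i, ∑ k, b i k * ∫ h, h i * h k ∂τ)| ≤ K * ∫ h, ‖h‖ ^ 3 ∂τ := by
      intro τ _ hτ
      have hc : ∀ i, MemLp (fun h : EuclideanSpace ℝ (Fin d) => h i) 3 τ := fun i =>
        hτ.mono (by fun_prop) (.of_forall fun h => PiLp.norm_apply_le h i)
      have hc2 : ∀ i, MemLp (fun h : EuclideanSpace ℝ (Fin d) => h i) 2 τ := fun i =>
        (hc i).mono_exponent (by norm_num)
      have i1 : ∀ i, Integrable (fun h : EuclideanSpace ℝ (Fin d) => a i * h i) τ := fun i =>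
        ((hc i).integrable (by norm_num)).const_mul _
      have i2 : ∀ i k, Integrable (fun h : EuclideanSpace ℝ (Fin d) => b i k * (h i * h k)) τ :=
        fun i k => ((hc2 i).integrable_mul (hc2 k)).const_mul _
      have i3 : Integrable (fun h : EuclideanSpace ℝ (Fin d) => K * ‖h‖ ^ 3) τ :=
        (hτ.integrable_norm_pow (by norm_num)).const_mul _
      have j1 : Integrable (fun h : EuclideanSpace ℝ (Fin d) => ∑ i, a i * h i) τ :=
        integrable_finsetSum _ fun i _ => i1 i
      have j2 : ∀ i, Integrable
          (fun h : EuclideanSpace ℝ (Fin d) => ∑ k, b i k * (h i * h k)) τ := fun i =>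
        integrable_finsetSum _ fun k _ => i2 i k
      have j3 : Integrable
          (fun h : EuclideanSpace ℝ (Fin d) => ∑ i, ∑ k, b i k * (h i * h k)) τ :=
        integrable_finsetSum _ fun i _ => j2 i
      have j4 : Integrable (fun h => f (x + h) - f x) τ :=
        (hshift τ inferInstance x).sub (integrable_const _)
      have e : ∫ h, (f (x + h) - f x - ∑ i, a i * h i - ∑ i, ∑ k, b i k * (h i * h k)) ∂τ =
          ∫ h, f (x + h) ∂τ - (f x + ∑ i, a i * ∫ h, h i ∂τ +
          ∑ i, ∑ k, b i k * ∫ h, h i * h k ∂τ) := by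
        rw [integral_sub (f := fun h => f (x + h) - f x - ∑ i, a i * h i) (j4.sub j1) j3,
          integral_sub j4 j1,
          integral_sub (hshift τ inferInstance x) (integrable_const _),
          integral_finsetSum _ fun i _ => i1 i, integral_finsetSum _ fun i _ => j2 i]
        simp_rw [integral_finsetSum _ fun k _ => i2 _ k, integral_const_mul]
        simp
        ring
      rw [← e, ← integral_const_mul, ← Real.norm_eq_abs]
      exact norm_integral_le_of_norm_le i3 (.of_forall hab)
    have k1 := abs_le.1 (key m inferInstance hm)
    have k2 := abs_le.1 (key g inferInstance hg)
    simp_rw [h1, h2] at k1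
    rw [mul_add]
    exact abs_le.2 ⟨by linarith [k1.1, k2.2], by linarith [k1.2, k2.1]⟩
  simp_rw [← Real.norm_eq_abs] at hpt ⊢
  simpa using norm_integral_le_of_norm_le_const (μ := ρ) (.of_forall hpt)

/-- Lindeberg's replacement argument for laws of sums of independent vectors. -/
lemma abs_integral_conv_map_sum_sub_le {ι Ω Ω' : Type*} [MeasurableSpace Ω] [MeasurableSpace Ω']
    {μ : Measure Ω} {ν : Measure Ω'} [IsProbabilityMeasure μ] [IsProbabilityMeasure ν]
    {X : ι → Ω → EuclideanSpace ℝ (Fin d)} {G : ι → Ω' → EuclideanSpace ℝ (Fin d)}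
    (hX : ∀ j, Measurable (X j)) (hG : ∀ j, Measurable (G j))
    (hXi : iIndepFun X μ) (hGi : iIndepFun G ν)
    (hX3 : ∀ j, MemLp (X j) 3 μ) (hG3 : ∀ j, MemLp (G j) 3 ν)
    (h1 : ∀ j i, ∫ ω, X j ω i ∂μ = ∫ ω, G j ω i ∂ν)
    (h2 : ∀ j i k, ∫ ω, X j ω i * X j ω k ∂μ = ∫ ω, G j ω i * G j ω k ∂ν)
    {f : EuclideanSpace ℝ (Fin d) → ℝ} {K B : ℝ}
    (hf : HasCubicExpansion f K) (hfc : Continuous f) (hfB : ∀ x, |f x| ≤ B)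
    (s : Finset ι) (ρ : Measure (EuclideanSpace ℝ (Fin d))) [IsProbabilityMeasure ρ] :
    |∫ x, f x ∂(ρ ∗ μ.map (∑ j ∈ s, X j)) - ∫ x, f x ∂(ρ ∗ ν.map (∑ j ∈ s, G j))| ≤
      K * ∑ j ∈ s, (∫ ω, ‖X j ω‖ ^ 3 ∂μ + ∫ ω, ‖G j ω‖ ^ 3 ∂ν) := by
  classical
  induction s using Finset.induction_on generalizing ρ with
  | empty =>
    simp only [Finset.sum_empty, Pi.zero_def, Measure.map_const]
    simp
  | insert j s hj ih =>
    have hXs : Measurable (∑ j ∈ s, X j) := by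
      rw [show ∑ j ∈ s, X j = fun ω => ∑ j ∈ s, X j ω by ext1 ω; simp]
      exact Finset.measurable_sum _ fun j _ => hX j
    have hGs : Measurable (∑ j ∈ s, G j) := by
      rw [show ∑ j ∈ s, G j = fun ω => ∑ j ∈ s, G j ω by ext1 ω; simp]
      exact Finset.measurable_sum _ fun j _ => hG j
    have := fun j => Measure.isProbabilityMeasure_map (μ := μ) (hX j).aemeasurable
    have := fun j => Measure.isProbabilityMeasure_map (μ := ν) (hG j).aemeasurable
    have := Measure.isProbabilityMeasure_map (μ := μ) hXs.aemeasurable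
    have := Measure.isProbabilityMeasure_map (μ := ν) hGs.aemeasurable
    rw [Finset.sum_insert hj, Finset.sum_insert hj, Finset.sum_insert hj,
      (hXi.indepFun_finsetSum_of_notMem hX hj).symm.map_add_eq_map_conv_map (hX j) hXs,
      (hGi.indepFun_finsetSum_of_notMem hG hj).symm.map_add_eq_map_conv_map (hG j) hGs]
    -- The measure `ρ` absorbs whatever is not being exchanged: first the law of `X j` while the sum
    -- over `s` is replaced, then the Gaussian sum while `X j` is replaced. Commutativity of
    -- convolution makes the two estimates meet.
    have a1 := ih (ρ ∗ μ.map (X j))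
    have a2 := abs_integral_conv_sub_le hf hfc hfB (ρ ∗ ν.map (∑ j ∈ s, G j)) (μ.map (X j))
      (ν.map (G j))
      ((memLp_map_measure_iff (by fun_prop) (hX j).aemeasurable).2 (by simpa using hX3 j))
      ((memLp_map_measure_iff (by fun_prop) (hG j).aemeasurable).2 (by simpa using hG3 j))
      (fun i => by
        rw [integral_map (hX j).aemeasurable (by fun_prop),
          integral_map (hG j).aemeasurable (by fun_prop), h1])
      (fun i k => by
        rw [integral_map (hX j).aemeasurable (by fun_prop),
          integral_map (hG j).aemeasurable (by fun_prop), h2])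
    rw [integral_map (hX j).aemeasurable (by fun_prop),
      integral_map (hG j).aemeasurable (by fun_prop)] at a2
    rw [Measure.conv_assoc, Measure.conv_assoc, Measure.conv_comm (ν.map (∑ j ∈ s, G j)),
      Measure.conv_comm (ν.map (∑ j ∈ s, G j))] at a2
    rw [Measure.conv_assoc, Measure.conv_assoc] at a1
    rw [mul_add]
    exact (abs_sub_le _ _ _).trans (by linarith)

lemma abs_integral_map_sum_sub_le {ι Ω Ω' : Type*} [Fintype ι]
    [MeasurableSpace Ω] [MeasurableSpace Ω']
    {μ : Measure Ω} {ν : Measure Ω'} [IsProbabilityMeasure μ] [IsProbabilityMeasure ν]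
    {X : ι → Ω → EuclideanSpace ℝ (Fin d)} {G : ι → Ω' → EuclideanSpace ℝ (Fin d)}
    (hX : ∀ j, Measurable (X j)) (hG : ∀ j, Measurable (G j))
    (hXi : iIndepFun X μ) (hGi : iIndepFun G ν)
    (hX3 : ∀ j, MemLp (X j) 3 μ) (hG3 : ∀ j, MemLp (G j) 3 ν)
    (h1 : ∀ j i, ∫ ω, X j ω i ∂μ = ∫ ω, G j ω i ∂ν)
    (h2 : ∀ j i k, ∫ ω, X j ω i * X j ω k ∂μ = ∫ ω, G j ω i * G j ω k ∂ν)
    {f : EuclideanSpace ℝ (Fin d) → ℝ} {K B : ℝ}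
    (hf : HasCubicExpansion f K) (hfc : Continuous f) (hfB : ∀ x, |f x| ≤ B) :
    |∫ x, f x ∂(μ.map fun ω => ∑ j, X j ω) - ∫ x, f x ∂(ν.map fun ω => ∑ j, G j ω)| ≤
      K * ∑ j, (∫ ω, ‖X j ω‖ ^ 3 ∂μ + ∫ ω, ‖G j ω‖ ^ 3 ∂ν) := by
  have := abs_integral_conv_map_sum_sub_le hX hG hXi hGi hX3 hG3 h1 h2 hf hfc hfB Finset.univ
    (Measure.dirac 0)
  rw [Measure.dirac_zero_conv, Measure.dirac_zero_conv] at this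
  convert this using 6 <;> ext1 ω <;> simp

/-! ### Third moments -/

lemma integral_mul_le_sqrt_mul_sqrt {Ω : Type*} [MeasurableSpace Ω] {μ : Measure Ω} {f g : Ω → ℝ}
    (hf0 : ∀ ω, 0 ≤ f ω) (hg0 : ∀ ω, 0 ≤ g ω) (hf : MemLp f 2 μ) (hg : MemLp g 2 μ) :
    ∫ ω, f ω * g ω ∂μ ≤ √(∫ ω, f ω ^ 2 ∂μ) * √(∫ ω, g ω ^ 2 ∂μ) := by
  have := integral_mul_le_Lp_mul_Lq_of_nonneg (μ := μ) Real.HolderConjugate.two_two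
    (.of_forall hf0) (.of_forall hg0) (by simpa using hf) (by simpa using hg)
  simpa [Real.sqrt_eq_rpow] using this

lemma lpNorm_natCast_pow_eq {Ω E : Type*} [MeasurableSpace Ω] [NormedAddCommGroup E]
    {μ : Measure Ω} {f : Ω → E} (hf : AEStronglyMeasurable f μ) {n : ℕ} (hn : n ≠ 0) :
    lpNorm f n μ ^ n = ∫ ω, ‖f ω‖ ^ n ∂μ := by
  rw [lpNorm_eq_integral_norm_rpow_toReal (by simpa using hn) (by simp) hf]
  simp only [ENNReal.toReal_natCast, Real.rpow_natCast]
  exact Real.rpow_inv_natCast_pow (integral_nonneg fun _ => by positivity) hn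

lemma memLp_norm_sq {Ω E : Type*} [MeasurableSpace Ω] [NormedAddCommGroup E]
    {μ : Measure Ω} {f : Ω → E} (hf : MemLp f 4 μ) : MemLp (fun ω => ‖f ω‖ ^ 2) 2 μ := by
  refine (memLp_two_iff_integrable_sq (hf.1.norm.pow 2)).2 ?_
  have := hf.integrable_norm_pow (p := 4) (by norm_num)
  simpa [← pow_mul] using this

lemma integral_norm_cube_le {Ω E : Type*} [MeasurableSpace Ω] [NormedAddCommGroup E]
    {μ : Measure Ω} [IsFiniteMeasure μ] {f : Ω → E} (hf : MemLp f 4 μ) :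
    ∫ ω, ‖f ω‖ ^ 3 ∂μ ≤ √(∫ ω, ‖f ω‖ ^ 2 ∂μ) * √(∫ ω, ‖f ω‖ ^ 4 ∂μ) := by
  have := integral_mul_le_sqrt_mul_sqrt (fun ω => norm_nonneg (f ω)) (fun ω => sq_nonneg ‖f ω‖)
    (hf.mono_exponent (by norm_num)).norm (memLp_norm_sq hf)
  simpa only [← pow_mul, ← pow_succ'] using this

/-- The case `a = 0` gives `‖X‖₄ ≤ η⁻¹ ‖X‖₂`, and Cauchy–Schwarz gives `E|X|³ ≤ ‖X‖₂ ‖X‖₄²`. -/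
lemma IsHC.integral_norm_cube_le {Ω : Type*} [MeasurableSpace Ω] {μ : Measure Ω}
    [IsProbabilityMeasure μ] {η : ℝ} {X : Ω → EuclideanSpace ℝ (Fin d)} (hX : IsHC μ η X) :
    ∫ ω, ‖X ω‖ ^ 3 ∂μ ≤ (η ^ 2)⁻¹ * lpNorm X 2 μ ^ 3 := by
  obtain ⟨h0, -, h4, h⟩ := hX
  have hm := h4.1
  have h2 : MemLp X 2 μ := h4.mono_exponent (by norm_num)
  have h := h 0
  simp only [zero_add] at h
  have h' : η * lpNorm X 4 μ ≤ lpNorm X 2 μ := by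
    have e := eLpNorm_const_smul η X 4 μ
    rw [show (fun ω => η • X ω) = η • X from rfl, e] at h
    have := ENNReal.toReal_mono h2.eLpNorm_ne_top h
    rwa [ENNReal.toReal_mul, toReal_enorm, toReal_eLpNorm hm, toReal_eLpNorm hm, Real.norm_eq_abs,
      abs_of_pos h0] at this
  have e4 : ∫ ω, ‖X ω‖ ^ 4 ∂μ = lpNorm X 4 μ ^ 4 :=
    (lpNorm_natCast_pow_eq hm (n := 4) (by norm_num)).symm
  have e2 : ∫ ω, ‖X ω‖ ^ 2 ∂μ = lpNorm X 2 μ ^ 2 :=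
    (lpNorm_natCast_pow_eq hm (n := 2) (by norm_num)).symm
  refine (MultiBE.integral_norm_cube_le h4).trans ?_
  have s4 : √(lpNorm X 4 μ ^ 4) = lpNorm X 4 μ ^ 2 := by
    rw [show lpNorm X 4 μ ^ 4 = (lpNorm X 4 μ ^ 2) ^ 2 by ring, Real.sqrt_sq (by positivity)]
  rw [e4, e2, s4, Real.sqrt_sq lpNorm_nonneg]
  have := pow_le_pow_left₀ (mul_nonneg h0.le lpNorm_nonneg) h' 2
  rw [← div_eq_inv_mul, le_div_iff₀ (by positivity)]
  nlinarith [lpNorm_nonneg (f := X) (p := 2) (μ := μ)]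

/-- The fourth moment of the standard normal distribution. -/
noncomputable def stdGaussianFourthMoment : ℝ := ∫ x, x ^ 4 ∂gaussianReal 0 1

lemma stdGaussianFourthMoment_nonneg : 0 ≤ stdGaussianFourthMoment :=
  integral_nonneg fun _ => by positivity

/-- `Y` has the law of a standard normal variable scaled by its standard deviation, which may be
zero. The numerical value of the fourth moment is never needed. -/
lemma integral_pow_four_of_hasGaussianLaw {Ω : Type*} [MeasurableSpace Ω] {μ : Measure Ω}
    {Y : Ω → ℝ} (hY : HasGaussianLaw Y μ) (h0 : ∫ ω, Y ω ∂μ = 0) :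
    ∫ ω, Y ω ^ 4 ∂μ = stdGaussianFourthMoment * (∫ ω, Y ω ^ 2 ∂μ) ^ 2 := by
  have := hY.isProbabilityMeasure
  have hv : Var[Y; μ] = ∫ ω, Y ω ^ 2 ∂μ :=
    variance_of_integral_eq_zero hY.aemeasurable h0
  have hv0 := variance_nonneg Y μ
  have hmap : μ.map Y = (gaussianReal 0 1).map (√Var[Y; μ] * ·) := by
    rw [hY.map_eq_gaussianReal, h0, gaussianReal_map_const_mul]
    congr 1
    · simp
    · ext
      simp [Real.sq_sqrt hv0, hv0]
  have e1 : ∫ ω, Y ω ^ 4 ∂μ = ∫ x, x ^ 4 ∂(μ.map Y) :=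
    (integral_map (f := fun x : ℝ => x ^ 4) hY.aemeasurable (by fun_prop)).symm
  rw [e1, hmap, integral_map (by fun_prop) (by fun_prop), ← hv]
  simp_rw [mul_pow]
  rw [integral_const_mul, mul_comm, stdGaussianFourthMoment]
  congr 1
  rw [show √Var[Y; μ] ^ 4 = (√Var[Y; μ] ^ 2) ^ 2 by ring, Real.sq_sqrt hv0]

/-- Expand `‖G‖⁴` as `∑ G_i² G_k²` and apply Cauchy–Schwarz to each term; the coordinates may be
arbitrarily correlated. -/
lemma integral_norm_pow_four_le_of_hasGaussianLaw {Ω : Type*} [MeasurableSpace Ω] {μ : Measure Ω}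
    {G : Ω → EuclideanSpace ℝ (Fin d)} (hG : HasGaussianLaw G μ) (h0 : ∀ i, ∫ ω, G ω i ∂μ = 0) :
    ∫ ω, ‖G ω‖ ^ 4 ∂μ ≤ stdGaussianFourthMoment * (∫ ω, ‖G ω‖ ^ 2 ∂μ) ^ 2 := by
  have := hG.isProbabilityMeasure
  have hi : ∀ i, HasGaussianLaw (fun ω => G ω i) μ := fun i =>
    hG.map_fun (EuclideanSpace.proj i : EuclideanSpace ℝ (Fin d) →L[ℝ] ℝ)
  have h4 : ∀ i, MemLp (fun ω => G ω i ^ 2) 2 μ := fun i => by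
    simpa using memLp_norm_sq ((hi i).memLp (p := 4) (by norm_num))
  have hint : ∀ i k, Integrable (fun ω => G ω i ^ 2 * G ω k ^ 2) μ := fun i k =>
    (h4 i).integrable_mul (h4 k)
  have e4 : ∀ ω, ‖G ω‖ ^ 4 = ∑ i, ∑ k, G ω i ^ 2 * G ω k ^ 2 := fun ω => by
    rw [show ‖G ω‖ ^ 4 = ‖G ω‖ ^ 2 * ‖G ω‖ ^ 2 by ring, EuclideanSpace.real_norm_sq_eq,
      Finset.sum_mul_sum]
  have e2 : ∫ ω, ‖G ω‖ ^ 2 ∂μ = ∑ i, ∫ ω, G ω i ^ 2 ∂μ := by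
    simp_rw [EuclideanSpace.real_norm_sq_eq]
    exact integral_finsetSum _ fun i _ => (h4 i).integrable (by norm_num)
  simp_rw [e4]
  rw [integral_finsetSum _ fun i _ => integrable_finsetSum _ fun k _ => hint i k]
  simp_rw [integral_finsetSum _ fun k _ => hint _ k]
  rw [e2, sq (∑ i, _), Finset.sum_mul_sum, Finset.mul_sum]
  refine Finset.sum_le_sum fun i _ => ?_
  rw [Finset.mul_sum]
  refine Finset.sum_le_sum fun k _ => ?_
  refine (integral_mul_le_sqrt_mul_sqrt (fun ω => sq_nonneg (G ω i)) (fun ω => sq_nonneg (G ω k))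
    (h4 i) (h4 k)).trans_eq ?_
  simp_rw [← pow_mul]
  rw [integral_pow_four_of_hasGaussianLaw (hi i) (h0 i),
    integral_pow_four_of_hasGaussianLaw (hi k) (h0 k),
    Real.sqrt_mul stdGaussianFourthMoment_nonneg, Real.sqrt_mul stdGaussianFourthMoment_nonneg,
    Real.sqrt_sq (integral_nonneg fun _ => by positivity),
    Real.sqrt_sq (integral_nonneg fun _ => by positivity), mul_mul_mul_comm,
    Real.mul_self_sqrt stdGaussianFourthMoment_nonneg]

lemma integral_norm_cube_le_of_hasGaussianLaw {Ω : Type*} [MeasurableSpace Ω] {μ : Measure Ω}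
    {G : Ω → EuclideanSpace ℝ (Fin d)} (hG : HasGaussianLaw G μ) (h0 : ∀ i, ∫ ω, G ω i ∂μ = 0) :
    ∫ ω, ‖G ω‖ ^ 3 ∂μ ≤ √stdGaussianFourthMoment * √(∫ ω, ‖G ω‖ ^ 2 ∂μ) ^ 3 := by
  have := hG.isProbabilityMeasure
  have h2 : 0 ≤ ∫ ω, ‖G ω‖ ^ 2 ∂μ := integral_nonneg fun _ => by positivity
  refine (integral_norm_cube_le (hG.memLp (by norm_num))).trans ?_
  have := Real.sqrt_le_sqrt (integral_norm_pow_four_le_of_hasGaussianLaw hG h0)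
  rw [Real.sqrt_mul stdGaussianFourthMoment_nonneg, Real.sqrt_sq h2] at this
  refine (mul_le_mul_of_nonneg_left this (Real.sqrt_nonneg _)).trans_eq ?_
  nth_rw 2 [← Real.sq_sqrt h2]
  ring

/-! ### Gaussian mean of the majorant -/

/-- The antiderivative `(2 / r) σ` increases from 0 to `2 / r`. -/
lemma integrable_bump {r : ℝ} (hr : 0 < r) (θ : ℝ) :
    Integrable (bump r θ) ∧ ∫ x, bump r θ x = 2 / r := by
  have hd : ∀ x, HasDerivAt (fun x => 2 / r * smoothSign r θ true 0 x) (bump r θ x) x := fun x => by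
    rw [bump_eq hr]
    exact (hasDerivAt_smoothSign r θ true 0 x).const_mul _
  have hle : ∀ x, 2 / r * smoothSign r θ true 0 x ≤ 2 / r := fun x =>
    mul_le_of_le_one_right (by positivity) (by
      rw [smoothSign_zero_true]
      exact Real.sigmoid_le_one _)
  have hint : Integrable (bump r θ) := by
    refine integrable_of_intervalIntegral_norm_bounded (2 / r)
      (l := Filter.atTop) (a := fun n : ℕ => -(n : ℝ)) (b := fun n : ℕ => (n : ℝ))
      (fun n => (continuous_bump r θ).continuousOn.integrableOn_Icc.mono_set Set.Ioc_subset_Icc_self)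
      (Filter.tendsto_neg_atTop_atBot.comp tendsto_natCast_atTop_atTop)
      tendsto_natCast_atTop_atTop (.of_forall fun n => ?_)
    simp_rw [Real.norm_of_nonneg (bump_nonneg r θ _)]
    rw [intervalIntegral.integral_eq_sub_of_hasDerivAt (fun x _ => hd x)
      ((continuous_bump r θ).intervalIntegrable _ _)]
    have := mul_nonneg (div_nonneg zero_le_two hr.le) (smoothSign_zero_nonneg r θ true (-(n : ℝ)))
    linarith [hle n]
  refine ⟨hint, ?_⟩
  have htop : Filter.Tendsto (fun x : ℝ => r * (x - θ)) Filter.atTop Filter.atTop :=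
    (Filter.tendsto_atTop_add_const_right _ (-θ) Filter.tendsto_id).const_mul_atTop hr
  have hbot : Filter.Tendsto (fun x : ℝ => r * (x - θ)) Filter.atBot Filter.atBot :=
    (Filter.tendsto_atBot_add_const_right _ (-θ) Filter.tendsto_id).const_mul_atBot hr
  rw [integral_of_hasDerivAt_of_tendsto hd hint (m := 2 / r * 0) (n := 2 / r * 1)]
  · ring
  · simp_rw [smoothSign_zero_true]
    exact (Real.tendsto_sigmoid_atBot.comp hbot).const_mul _
  · simp_rw [smoothSign_zero_true]
    exact (Real.tendsto_sigmoid_atTop.comp htop).const_mul _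

lemma gaussianPDFReal_zero_one_le_one (x : ℝ) : gaussianPDFReal 0 1 x ≤ 1 := by
  have h1 : 1 ≤ √(2 * Real.pi * ((1 : NNReal) : ℝ)) :=
    Real.one_le_sqrt.2 (by simp; linarith [Real.pi_gt_three])
  have h2 : Real.exp (-(x - 0) ^ 2 / (2 * ((1 : NNReal) : ℝ))) ≤ 1 :=
    Real.exp_le_one_iff.2
      (div_nonpos_of_nonpos_of_nonneg (neg_nonpos.2 (sq_nonneg _)) (by positivity))
  exact mul_le_one₀ (inv_le_one_of_one_le₀ h1) (Real.exp_nonneg _) h2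

/-- Unit variance makes the density at most 1, so the mean is at most the Lebesgue integral. -/
lemma integral_bump_le_of_hasGaussianLaw {Ω : Type*} [MeasurableSpace Ω] {μ : Measure Ω}
    {Y : Ω → ℝ} (hY : HasGaussianLaw Y μ) (h0 : ∫ ω, Y ω ∂μ = 0) (h1 : Var[Y; μ] = 1)
    {r : ℝ} (hr : 0 < r) (θ : ℝ) : ∫ ω, bump r θ (Y ω) ∂μ ≤ 2 / r := by
  obtain ⟨hb, hb'⟩ := integrable_bump hr θ
  have e : ∫ ω, bump r θ (Y ω) ∂μ = ∫ x, bump r θ x ∂(μ.map Y) :=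
    (integral_map hY.aemeasurable (continuous_bump r θ).aestronglyMeasurable).symm
  rw [e, hY.map_eq_gaussianReal, h0, h1, Real.toNNReal_one,
    integral_gaussianReal_eq_integral_smul one_ne_zero, ← hb']
  have hle : ∀ x, gaussianPDFReal 0 1 x • bump r θ x ≤ bump r θ x := fun x =>
    mul_le_of_le_one_left (bump_nonneg r θ x) (gaussianPDFReal_zero_one_le_one x)
  refine integral_mono_of_nonneg (.of_forall fun x => ?_) hb (.of_forall hle)
  exact mul_nonneg (gaussianPDFReal_nonneg _ _ _) (bump_nonneg r θ x)

/-! ### Sign patterns and the smoothing inequality -/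

/-- The sign pattern of `x - θ`. -/
noncomputable def signPattern (θ x : EuclideanSpace ℝ (Fin d)) : Fin d → Bool :=
  fun i => decide (θ i ≤ x i)

/-- A point with a prescribed sign pattern with respect to `θ`. -/
noncomputable def signPoint (θ : EuclideanSpace ℝ (Fin d)) (s : Fin d → Bool) :
    EuclideanSpace ℝ (Fin d) :=
  WithLp.toLp 2 fun i => θ i + if s i then 0 else -1

/-- Membership in `A` is thereby decided at finitely many points. The offset 0 counts as positive
because `sgn 0 = 1`. -/
lemma vecSgn_signPoint_signPattern (θ x : EuclideanSpace ℝ (Fin d)) :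
    vecSgn (signPoint θ (signPattern θ x) - θ) = vecSgn (x - θ) := by
  funext i
  by_cases h : θ i ≤ x i <;> simp [vecSgn, sgn, signPoint, signPattern, h]

lemma measurable_signPattern (θ : EuclideanSpace ℝ (Fin d)) : Measurable (signPattern θ) := by
  refine measurable_pi_lambda _ fun i => measurable_to_bool ?_
  have : (fun x => signPattern θ x i) ⁻¹' {true} = {x | θ i ≤ x i} := by
    ext x
    simp [signPattern]
  rw [this]
  exact measurableSet_le measurable_const (by fun_prop)

lemma one_sub_prod_le_sum {ι : Type*} (s : Finset ι) {u : ι → ℝ} (h0 : ∀ i, 0 ≤ u i)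
    (h1 : ∀ i, u i ≤ 1) : 1 - ∏ i ∈ s, u i ≤ ∑ i ∈ s, (1 - u i) := by
  classical
  induction s using Finset.induction_on with
  | empty => simp
  | insert j s hj ih =>
    rw [Finset.prod_insert hj, Finset.sum_insert hj]
    have h2 : 0 ≤ ∏ i ∈ s, u i := Finset.prod_nonneg fun i _ => h0 i
    have h3 : ∏ i ∈ s, u i ≤ 1 := Finset.prod_le_one (fun i _ => h0 i) fun i _ => h1 i
    nlinarith [h0 j, h1 j, mul_nonneg (sub_nonneg.2 (h1 j)) (sub_nonneg.2 h3)]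

lemma sum_smoothSign_zero (r θ x : ℝ) : ∑ s, smoothSign r θ s 0 x = 1 := by
  simp [smoothSign_zero_true, smoothSign_zero_false]

lemma smoothSign_zero_le_one (r θ : ℝ) (s : Bool) (x : ℝ) : smoothSign r θ s 0 x ≤ 1 :=
  (Finset.single_le_sum (f := fun s => smoothSign r θ s 0 x)
    (fun _ _ => smoothSign_zero_nonneg _ _ _ _) (Finset.mem_univ s)).trans_eq
    (sum_smoothSign_zero r θ x)

/-- The weight `p` given to the correct side is at least 1/2, hence `1 - p ≤ 2 p (1 - p)`; this is
the factor 2 in `bump`. -/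
lemma one_sub_smoothSign_le_bump {r : ℝ} (hr : 0 ≤ r) (θ x : ℝ) :
    1 - smoothSign r θ (decide (θ ≤ x)) 0 x ≤ bump r θ x := by
  have h0 := Real.sigmoid_nonneg (r * (x - θ))
  have h1 := Real.sigmoid_le_one (r * (x - θ))
  unfold bump
  by_cases h : θ ≤ x
  · have : Real.sigmoid 0 ≤ Real.sigmoid (r * (x - θ)) :=
      Real.sigmoid_le (mul_nonneg hr (sub_nonneg.2 h))
    rw [Real.sigmoid_zero] at this
    simp only [h, decide_true, smoothSign_zero_true]
    nlinarith
  · have : Real.sigmoid (r * (x - θ)) ≤ Real.sigmoid 0 :=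
      Real.sigmoid_le (mul_nonpos_of_nonneg_of_nonpos hr (by linarith))
    rw [Real.sigmoid_zero] at this
    simp only [h, decide_false, smoothSign_zero_false]
    nlinarith

/-- The products `w s` are probability weights on sign patterns, and the smoothed function averages
`c` against them. Its distance from `c t` is at most the mass `1 - w t` off the true pattern, which
a union bound splits into coordinates. -/
lemma abs_sub_smoothOrthants_le {r : ℝ} (hr : 0 ≤ r) (θ : EuclideanSpace ℝ (Fin d))
    {c : (Fin d → Bool) → ℝ} (hc0 : ∀ s, 0 ≤ c s) (hc1 : ∀ s, c s ≤ 1)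
    (x : EuclideanSpace ℝ (Fin d)) :
    |c (signPattern θ x) - smoothOrthants r θ c 0 x| ≤ ∑ i, bump r (θ i) (x i) := by
  classical
  set t := signPattern θ x
  set w : (Fin d → Bool) → ℝ := fun s => ∏ l, smoothSign r (θ l) (s l) 0 (x l) with hw
  have hw0 : ∀ s, 0 ≤ w s := fun s => Finset.prod_nonneg fun l _ => smoothSign_zero_nonneg _ _ _ _
  have hw1 : ∑ s, w s = 1 := by
    have := (Finset.prod_univ_sum (fun _ : Fin d => (Finset.univ : Finset Bool))
      fun l b => smoothSign r (θ l) b 0 (x l)).symm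
    rw [Fintype.piFinset_univ] at this
    exact this.trans (Finset.prod_eq_one fun l _ => sum_smoothSign_zero _ _ _)
  have e : c t - smoothOrthants r θ c 0 x = ∑ s, (c t - c s) * w s := by
    simp only [sub_mul, Finset.sum_sub_distrib, ← Finset.mul_sum, hw1, mul_one]
    rfl
  rw [e]
  calc |∑ s, (c t - c s) * w s| ≤ ∑ s, |(c t - c s) * w s| := Finset.abs_sum_le_sum_abs _ _
    _ ≤ ∑ s, (w s - if s = t then w s else 0) := by
        refine Finset.sum_le_sum fun s _ => ?_
        split_ifs with h
        · simp [h]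
        · rw [abs_mul, abs_of_nonneg (hw0 s), sub_zero]
          exact mul_le_of_le_one_left (hw0 s)
            (abs_le.2 ⟨by linarith [hc0 t, hc1 s], by linarith [hc1 t, hc0 s]⟩)
    _ = 1 - w t := by simp [Finset.sum_sub_distrib, hw1]
    _ ≤ ∑ l, (1 - smoothSign r (θ l) (t l) 0 (x l)) :=
        one_sub_prod_le_sum _ (fun l => smoothSign_zero_nonneg _ _ _ _)
          fun l => smoothSign_zero_le_one _ _ _ _
    _ ≤ _ := Finset.sum_le_sum fun l _ => one_sub_smoothSign_le_bump hr _ _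

lemma IsTranslateUnionOrthants.measurableSet {A : Set (EuclideanSpace ℝ (Fin d))}
    (hA : IsTranslateUnionOrthants A) : MeasurableSet A := by
  obtain ⟨θ, hA⟩ := hA
  have : A = signPattern θ ⁻¹' {s | signPoint θ s ∈ A} := by
    ext x
    exact (hA _ _ (vecSgn_signPoint_signPattern θ x)).symm
  rw [this]
  exact measurable_signPattern θ (Set.toFinite _).measurableSet

/-- Smoothing inequality: probabilities of a union of orthants are compared through integrals of
smooth functions. -/
lemma abs_measureReal_sub_le (P Q : Measure (EuclideanSpace ℝ (Fin d)))
    [IsProbabilityMeasure P] [IsProbabilityMeasure Q] {r : ℝ} (hr : 0 < r) {Δ : ℝ}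
    (hPQ : ∀ (f : EuclideanSpace ℝ (Fin d) → ℝ) (K : ℝ), HasCubicExpansion f K → Continuous f →
      (∀ x, |f x| ≤ 1) → |∫ x, f x ∂P - ∫ x, f x ∂Q| ≤ K * Δ)
    (hQ : ∀ i θ, ∫ x, bump r θ (x i) ∂Q ≤ 2 / r)
    {A : Set (EuclideanSpace ℝ (Fin d))} (hA : IsTranslateUnionOrthants A) :
    |P.real A - Q.real A| ≤
      (d : ℝ) ^ (3 / 2 : ℝ) * r ^ 3 * Δ + d * (2 * r ^ 3 * Δ + 2 * (2 / r)) := by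
  classical
  have hAm := hA.measurableSet
  obtain ⟨θ, hA⟩ := hA
  set c : (Fin d → Bool) → ℝ := fun s => if signPoint θ s ∈ A then 1 else 0 with hc
  have hc0 : ∀ s, 0 ≤ c s := fun s => by simp only [hc]; split_ifs <;> norm_num
  have hc1 : ∀ s, c s ≤ 1 := fun s => by simp only [hc]; split_ifs <;> norm_num
  have hcA : ∀ s, |c s| ≤ 1 := fun s => abs_le.2 ⟨by linarith [hc0 s], hc1 s⟩
  have hind : ∀ x, c (signPattern θ x) = A.indicator 1 x := fun x => by
    have := hA _ _ (vecSgn_signPoint_signPattern θ x)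
    by_cases hx : x ∈ A <;> simp [hc, this, hx]
  have hψ1 : ∀ x, |smoothOrthants r θ c 0 x| ≤ 1 := fun x => by
    simpa using abs_smoothOrthants_le hr.le θ hcA (α := 0) (by simp) x
  have hψc := continuous_smoothOrthants r θ c 0
  have hqc : ∀ i, Continuous fun x : EuclideanSpace ℝ (Fin d) => bump r (θ i) (x i) := fun i =>
    (continuous_bump r (θ i)).comp (by fun_prop)
  have hq1 : ∀ i, ∀ x : EuclideanSpace ℝ (Fin d), |bump r (θ i) (x i)| ≤ 1 := fun i x => by
    rw [abs_of_nonneg (bump_nonneg _ _ _)]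
    exact bump_le_one _ _ _
  have happrox : ∀ τ : Measure (EuclideanSpace ℝ (Fin d)), IsProbabilityMeasure τ →
      |τ.real A - ∫ x, smoothOrthants r θ c 0 x ∂τ| ≤ ∑ i, ∫ x, bump r (θ i) (x i) ∂τ := by
    intro τ _
    have iq : ∀ i, Integrable (fun x : EuclideanSpace ℝ (Fin d) => bump r (θ i) (x i)) τ := fun i =>
      Integrable.of_bound (hqc i).aestronglyMeasurable 1 (.of_forall (hq1 i))
    rw [← integral_indicator_one hAm, ← integral_sub
      (f := A.indicator 1) ((integrable_const (1 : ℝ)).indicator hAm)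
      (Integrable.of_bound hψc.aestronglyMeasurable 1 (.of_forall hψ1)),
      ← integral_finsetSum _ fun i _ => iq i, ← Real.norm_eq_abs]
    refine norm_integral_le_of_norm_le (integrable_finsetSum _ fun i _ => iq i)
      (.of_forall fun x => ?_)
    rw [← hind x]
    exact abs_sub_smoothOrthants_le hr.le θ hc0 hc1 x
  have hψ := hPQ _ _ (hasCubicExpansion_smoothOrthants hr.le θ hcA) hψc hψ1
  -- Anticoncentration is transferred from `Q` to `P`, by comparing the integrals of the smooth
  -- majorant.
  have hP : ∑ i, ∫ x, bump r (θ i) (x i) ∂P ≤ d * (2 * r ^ 3 * Δ + 2 / r) := by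
    refine (Finset.sum_le_card_nsmul _ _ (2 * r ^ 3 * Δ + 2 / r) fun i _ => ?_).trans_eq
      (by simp [mul_add])
    have := (abs_le.1 (hPQ _ _ (hasCubicExpansion_bump hr (θ i) i) (hqc i) (hq1 i))).2
    linarith [hQ i (θ i)]
  have hQ' : ∑ i, ∫ x, bump r (θ i) (x i) ∂Q ≤ d * (2 / r) :=
    (Finset.sum_le_card_nsmul _ _ (2 / r) fun i _ => hQ i (θ i)).trans_eq (by simp)
  have b1 := abs_le.1 (happrox P inferInstance)
  have b2 := abs_le.1 (happrox Q inferInstance)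
  have b3 := abs_le.1 hψ
  exact abs_le.2 ⟨by linarith [b1.1, b2.2, b3.1], by linarith [b1.2, b2.1, b3.2]⟩

/-! ### Covariances of sums and traces -/

lemma covMatrix_sum_apply_self {ι Ω : Type*} [Fintype ι] [MeasurableSpace Ω] {μ : Measure Ω}
    [IsProbabilityMeasure μ] {X : ι → Ω → EuclideanSpace ℝ (Fin d)}
    (hXi : iIndepFun X μ) (hX2 : ∀ j, MemLp (X j) 2 μ) (i : Fin d) :
    covMatrix μ (fun ω => ∑ j, X j ω) i i = ∑ j, covMatrix μ (X j) i i := by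
  have h2 : ∀ j, MemLp (fun ω => X j ω i) 2 μ := fun j =>
    (hX2 j).mono ((EuclideanSpace.proj i : EuclideanSpace ℝ (Fin d) →L[ℝ] ℝ).continuous
      |>.comp_aestronglyMeasurable (hX2 j).1) (.of_forall fun ω => PiLp.norm_apply_le _ i)
  have hs : (fun ω => (∑ j, X j ω) i) = ∑ j, fun ω => X j ω i := by
    ext ω
    simp
  simp only [covMatrix, Matrix.of_apply]
  rw [hs, covariance_self (memLp_finsetSum' _ fun j _ => h2 j).aemeasurable,
    IndepFun.variance_sum (fun j _ => h2 j) fun j _ k _ hjk =>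
      (hXi.indepFun hjk).comp (φ := fun x : EuclideanSpace ℝ (Fin d) => x i)
        (ψ := fun x : EuclideanSpace ℝ (Fin d) => x i) (by fun_prop) (by fun_prop)]
  exact Finset.sum_congr rfl fun j _ => (covariance_self (h2 j).aemeasurable).symm

lemma integral_apply_eq_zero {Ω : Type*} [MeasurableSpace Ω] {μ : Measure Ω}
    {Y : Ω → EuclideanSpace ℝ (Fin d)} (hY : Integrable Y μ) (h0 : ∫ ω, Y ω ∂μ = 0) (i : Fin d) :
    ∫ ω, Y ω i ∂μ = 0 := by
  have := (EuclideanSpace.proj i : EuclideanSpace ℝ (Fin d) →L[ℝ] ℝ).integral_comp_comm hY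
  simpa [h0] using this

lemma covMatrix_apply_of_integral_eq_zero {Ω : Type*} [MeasurableSpace Ω] {μ : Measure Ω}
    {Y : Ω → EuclideanSpace ℝ (Fin d)} (h0 : ∀ i, ∫ ω, Y ω i ∂μ = 0) (i k : Fin d) :
    covMatrix μ Y i k = ∫ ω, Y ω i * Y ω k ∂μ := by
  simp [covMatrix, covariance, h0]

lemma integral_norm_sq_eq_trace {Ω : Type*} [MeasurableSpace Ω] {μ : Measure Ω}
    {Y : Ω → EuclideanSpace ℝ (Fin d)} (hY : MemLp Y 2 μ) (h0 : ∀ i, ∫ ω, Y ω i ∂μ = 0) :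
    ∫ ω, ‖Y ω‖ ^ 2 ∂μ = ∑ i, covMatrix μ Y i i := by
  have h2 : ∀ i, MemLp (fun ω => Y ω i) 2 μ := fun i =>
    hY.mono ((EuclideanSpace.proj i : EuclideanSpace ℝ (Fin d) →L[ℝ] ℝ).continuous
      |>.comp_aestronglyMeasurable hY.1) (.of_forall fun ω => PiLp.norm_apply_le _ i)
  simp_rw [covMatrix_apply_of_integral_eq_zero h0, EuclideanSpace.real_norm_sq_eq, ← sq]
  exact integral_finsetSum _ fun i _ => (h2 i).integrable_sq

/-! ### Choice of the smoothing parameter -/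

/-- The smoothing parameter is chosen in terms of `D = d^{1/8}`, `e = η^{1/2}` and
`t = (∑ σ⁴)^{1/8}`. -/
lemma smoothing_bound_le {D e t κ Δ : ℝ} (hD : 1 ≤ D) (he : 0 < e) (ht : 0 < t) (hκ : 0 ≤ κ)
    (hΔ : Δ ≤ κ * (e ^ 4)⁻¹ * (D ^ 4 * t ^ 4)) {r : ℝ} (hr : r = e / (t * D ^ 5)) :
    D ^ 12 * r ^ 3 * Δ + D ^ 8 * (2 * r ^ 3 * Δ + 2 * (2 / r)) ≤
      (3 * κ + 4) * e⁻¹ * D ^ 13 * t := by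
  have hD0 : 0 < D := by linarith
  have hr0 : 0 < r := by rw [hr]; positivity
  have hDD : D ^ 8 ≤ D ^ 12 := pow_le_pow_right₀ hD (by norm_num)
  have hDD' : D ≤ D ^ 13 := le_self_pow₀ hD (by norm_num)
  have h1 : D ^ 12 * r ^ 3 * Δ + D ^ 8 * (2 * r ^ 3 * Δ + 2 * (2 / r)) ≤
      3 * (D ^ 12 * r ^ 3 * (κ * (e ^ 4)⁻¹ * (D ^ 4 * t ^ 4))) + D ^ 8 * (4 / r) := by
    have a : D ^ 12 * r ^ 3 * Δ ≤ D ^ 12 * r ^ 3 * (κ * (e ^ 4)⁻¹ * (D ^ 4 * t ^ 4)) := by gcongr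
    have b : D ^ 8 * r ^ 3 * Δ ≤ D ^ 12 * r ^ 3 * (κ * (e ^ 4)⁻¹ * (D ^ 4 * t ^ 4)) := by
      have : D ^ 8 * r ^ 3 * Δ ≤ D ^ 8 * r ^ 3 * (κ * (e ^ 4)⁻¹ * (D ^ 4 * t ^ 4)) := by gcongr
      refine this.trans ?_
      gcongr
    have c : D ^ 8 * (2 * (2 / r)) = D ^ 8 * (4 / r) := by ring
    linarith
  refine h1.trans ?_
  -- In `e` and `t` the choice of `r` balances `r³ e⁻⁴ t⁴` against `1 / r`. In `D` it does not: `D ^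
  -- 5` is the largest power keeping `D ^ 8 / r` within `D ^ 13`, and it leaves the exchange term
  -- with a single `D`.
  have h2 : 3 * (D ^ 12 * r ^ 3 * (κ * (e ^ 4)⁻¹ * (D ^ 4 * t ^ 4))) = 3 * κ * e⁻¹ * D * t := by
    rw [hr]
    field_simp
  have h3 : D ^ 8 * (4 / r) = 4 * e⁻¹ * D ^ 13 * t := by
    rw [hr]
    field_simp
  rw [h2, h3]
  have : 3 * κ * e⁻¹ * D * t ≤ 3 * κ * e⁻¹ * D ^ 13 * t := by gcongr
  linarith

lemma sum_cube_le_sqrt_mul_sqrt {ι : Type*} [Fintype ι] {σ : ι → ℝ} :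
    ∑ j, σ j ^ 3 ≤ √(∑ j, σ j ^ 2) * √(∑ j, σ j ^ 4) := by
  have := Real.sum_mul_le_sqrt_mul_sqrt Finset.univ σ (fun j => σ j ^ 2)
  simpa only [← pow_mul, ← pow_succ'] using this

end

end MultiBE

/-! ### The Berry–Esseen bound -/

open MultiBE in
theorem mainTheorem5 :
    ∃ C : ℝ, ∀ (d n : ℕ) (η : ℝ)
      (Ω : Type*) [MeasurableSpace Ω] (μ : Measure Ω) [IsProbabilityMeasure μ]
      (X : Fin n → Ω → EuclideanSpace ℝ (Fin d))
      (Ω' : Type*) [MeasurableSpace Ω'] (ν : Measure Ω') [IsProbabilityMeasure ν]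
      (G : Fin n → Ω' → EuclideanSpace ℝ (Fin d))
      (A : Set (EuclideanSpace ℝ (Fin d))),
      (∀ j, Measurable (X j)) →
      iIndepFun X μ →
      (∀ j, MultiBE.IsHC μ η (X j)) →
      (∀ j, ∫ ω, X j ω ∂μ = 0) →
      (∀ i, MultiBE.covMatrix μ (fun ω => ∑ j, X j ω) i i = 1) →
      (∀ j, Measurable (G j)) →
      iIndepFun G ν →
      (∀ j, HasGaussianLaw (G j) ν) →
      (∀ j, ∫ ω, G j ω ∂ν = 0) →
      (∀ j, MultiBE.covMatrix ν (G j) = MultiBE.covMatrix μ (X j)) →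
      MultiBE.IsTranslateUnionOrthants A →
      |μ.real {ω | ∑ j, X j ω ∈ A} - ν.real {ω | ∑ j, G j ω ∈ A}| ≤
        C * η ^ (-(1 / 2) : ℝ) * (d : ℝ) ^ (13 / 8 : ℝ) *
          (∑ j, lpNorm (X j) 2 μ ^ 4) ^ (1 / 8 : ℝ) := by
  refine ⟨3 * (1 + √stdGaussianFourthMoment) + 4, ?_⟩
  intro d n η Ω _ μ _ X Ω' _ ν _ G A hXm hXi hHC hX0 hcov hGm hGi hGG hG0 hGX hA
  -- In dimension zero the space is a point, so `A` is empty or everything and both sides vanish.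
  rcases Nat.eq_zero_or_pos d with rfl | hd
  · rcases Subsingleton.set_cases (p := fun A : Set (EuclideanSpace ℝ (Fin 0)) =>
      μ.real {ω | ∑ j, X j ω ∈ A} = ν.real {ω | ∑ j, G j ω ∈ A}) (by simp) (by simp) A with h
    rw [h]
    simp
  have hX4 : ∀ j, MemLp (X j) 4 μ := fun j => (hHC j).2.2.1
  have hX2 : ∀ j, MemLp (X j) 2 μ := fun j => (hX4 j).mono_exponent (by norm_num)
  have hX3 : ∀ j, MemLp (X j) 3 μ := fun j => (hX4 j).mono_exponent (by norm_num)
  have hG2 : ∀ j, MemLp (G j) 2 ν := fun j => (hGG j).memLp (by norm_num)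
  have hG3 : ∀ j, MemLp (G j) 3 ν := fun j => (hGG j).memLp (by norm_num)
  have hX0' : ∀ j i, ∫ ω, X j ω i ∂μ = 0 := fun j i =>
    integral_apply_eq_zero ((hX2 j).integrable (by norm_num)) (hX0 j) i
  have hG0' : ∀ j i, ∫ ω, G j ω i ∂ν = 0 := fun j i =>
    integral_apply_eq_zero ((hG2 j).integrable (by norm_num)) (hG0 j) i
  set σ : Fin n → ℝ := fun j => lpNorm (X j) 2 μ with hσ
  have hσ0 : ∀ j, 0 ≤ σ j := fun j => lpNorm_nonneg
  have hσ2 : ∀ j, σ j ^ 2 = ∑ i, covMatrix μ (X j) i i := fun j => by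
    rw [← integral_norm_sq_eq_trace (hX2 j) (hX0' j)]
    exact lpNorm_natCast_pow_eq (hX2 j).1 (n := 2) (by norm_num)
  have hσG : ∀ j, √(∫ ω, ‖G j ω‖ ^ 2 ∂ν) = σ j := fun j => by
    rw [integral_norm_sq_eq_trace (hG2 j) (hG0' j), hGX j, ← hσ2 j, Real.sqrt_sq (hσ0 j)]
  have hσd : ∑ j, σ j ^ 2 = d := by
    simp_rw [hσ2]
    rw [Finset.sum_comm]
    simp_rw [← covMatrix_sum_apply_self hXi hX2, hcov]
    simp
  have hd1 : (1 : ℝ) ≤ d := by exact_mod_cast hd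
  -- The bounds on `η` are part of `IsHC`, so an index is needed to extract them; `∑ σ_j² = d > 0`
  -- provides one, with `σ j₀ ≠ 0`, which also gives `T > 0`.
  obtain ⟨j₀, -, hj₀⟩ : ∃ j ∈ Finset.univ, σ j ^ 2 ≠ 0 :=
    Finset.exists_ne_zero_of_sum_ne_zero (by rw [hσd]; positivity)
  have hη : 0 < η := (hHC j₀).1
  have hη1 : η < 1 := (hHC j₀).2.1
  have hT : 0 < ∑ j, σ j ^ 4 :=
    Finset.sum_pos' (fun j _ => by positivity) ⟨j₀, Finset.mem_univ _, by
      have : 0 < σ j₀ := lt_of_le_of_ne (hσ0 j₀) fun h => hj₀ (by simp [← h])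
      positivity⟩
  set T := ∑ j, σ j ^ 4
  set Δ := ∑ j, (∫ ω, ‖X j ω‖ ^ 3 ∂μ + ∫ ω, ‖G j ω‖ ^ 3 ∂ν)
  set κ := 1 + √stdGaussianFourthMoment with hκdef
  have hκ : 0 ≤ κ := by positivity
  -- This lets the Gaussian third moments, free of `η`, be absorbed into the same bound.
  have hη2 : 1 ≤ (η ^ 2)⁻¹ := (one_le_inv₀ (by positivity)).2 (pow_le_one₀ hη.le hη1.le)
  have hΔ : Δ ≤ κ * (η ^ 2)⁻¹ * (√d * √T) := by
    calc Δ ≤ ∑ j, κ * (η ^ 2)⁻¹ * σ j ^ 3 := by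
          refine Finset.sum_le_sum fun j _ => ?_
          have h1 := (hHC j).integral_norm_cube_le
          have h2 := integral_norm_cube_le_of_hasGaussianLaw (hGG j) (hG0' j)
          rw [hσG j] at h2
          have h3 : √stdGaussianFourthMoment * σ j ^ 3 ≤
              √stdGaussianFourthMoment * (η ^ 2)⁻¹ * σ j ^ 3 :=
            mul_le_mul_of_nonneg_right (le_mul_of_one_le_right (Real.sqrt_nonneg _) hη2)
              (pow_nonneg (hσ0 j) 3)
          simp only [hκdef, add_mul, one_mul]
          exact add_le_add h1 (h2.trans h3)
      _ = κ * (η ^ 2)⁻¹ * ∑ j, σ j ^ 3 := (Finset.mul_sum _ _ _).symm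
      _ ≤ _ := by
          rw [← hσd]
          exact mul_le_mul_of_nonneg_left sum_cube_le_sqrt_mul_sqrt (by positivity)
  have hXs : Measurable fun ω => ∑ j, X j ω := Finset.measurable_sum _ fun j _ => hXm j
  have hGs : Measurable fun ω => ∑ j, G j ω := Finset.measurable_sum _ fun j _ => hGm j
  have := Measure.isProbabilityMeasure_map (μ := μ) hXs.aemeasurable
  have := Measure.isProbabilityMeasure_map (μ := ν) hGs.aemeasurable
  have hGS : HasGaussianLaw (fun ω => ∑ j, G j ω) ν := hGi.hasGaussianLaw_fun_sum hGG
  have hGSi : ∀ i, HasGaussianLaw (fun ω => (∑ j, G j ω) i) ν := fun i =>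
    hGS.map_fun (EuclideanSpace.proj i : EuclideanSpace ℝ (Fin d) →L[ℝ] ℝ)
  have hGSvar : ∀ i, Var[fun ω => (∑ j, G j ω) i; ν] = 1 := fun i => by
    rw [← covariance_self (hGSi i).aemeasurable]
    have h1 := covMatrix_sum_apply_self hGi hG2 i
    simp_rw [hGX] at h1
    rw [← covMatrix_sum_apply_self hXi hX2 i, hcov] at h1
    exact h1
  have hGS0 : ∀ i, ∫ ω, (∑ j, G j ω) i ∂ν = 0 := fun i =>
    integral_apply_eq_zero hGS.integrable (by
      rw [integral_finsetSum _ fun j _ => (hG2 j).integrable (by norm_num)]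
      simp [hG0]) i
  -- With eighth roots of `d` and `T` and the square root of `η`, all real exponents become
  -- integers.
  obtain ⟨D, hD⟩ : ∃ D : ℝ, D = (d : ℝ) ^ (1 / 8 : ℝ) := ⟨_, rfl⟩
  obtain ⟨e, he0, he⟩ : ∃ e : ℝ, 0 < e ∧ e = η ^ (1 / 2 : ℝ) := ⟨_, by positivity, rfl⟩
  obtain ⟨t, ht0, ht⟩ : ∃ t : ℝ, 0 < t ∧ t = T ^ (1 / 8 : ℝ) := ⟨_, by positivity, rfl⟩
  have hpow : ∀ {x : ℝ} (p : ℝ) (k : ℕ), 0 ≤ x → (x ^ p) ^ k = x ^ (p * k) := fun p k hx => by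
    rw [Real.rpow_mul hx, Real.rpow_natCast]
  have hd0 : (0 : ℝ) ≤ d := by positivity
  have hD1 : 1 ≤ D := hD ▸ Real.one_le_rpow hd1 (by norm_num)
  have hD4 : √(d : ℝ) = D ^ 4 := by
    rw [hD, hpow _ _ hd0, Real.sqrt_eq_rpow]; norm_num
  have hD8 : (d : ℝ) = D ^ 8 := by rw [hD, hpow _ _ hd0]; norm_num
  have hD12 : (d : ℝ) ^ (3 / 2 : ℝ) = D ^ 12 := by rw [hD, hpow _ _ hd0]; norm_num
  have hD13 : (d : ℝ) ^ (13 / 8 : ℝ) = D ^ 13 := by rw [hD, hpow _ _ hd0]; norm_num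
  have ht4 : √T = t ^ 4 := by
    rw [ht, hpow _ _ hT.le, Real.sqrt_eq_rpow]; norm_num
  have he2 : η ^ 2 = e ^ 4 := by
    rw [he, hpow _ _ hη.le, ← Real.rpow_natCast]; norm_num
  have he1 : η ^ (-(1 / 2) : ℝ) = e⁻¹ := by rw [he, Real.rpow_neg hη.le]
  have hr : 0 < e / (t * D ^ 5) := by positivity
  have key := abs_measureReal_sub_le (μ.map fun ω => ∑ j, X j ω) (ν.map fun ω => ∑ j, G j ω) hr
    (Δ := Δ) (fun f K hf hfc hfB =>
      abs_integral_map_sum_sub_le hXm hGm hXi hGi hX3 hG3 (fun j i => by rw [hX0', hG0'])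
        (fun j i k => by
          rw [← covMatrix_apply_of_integral_eq_zero (hX0' j),
            ← covMatrix_apply_of_integral_eq_zero (hG0' j), hGX]) hf hfc hfB)
    (fun i θ => by
      have hc : Continuous fun x : EuclideanSpace ℝ (Fin d) => bump (e / (t * D ^ 5)) θ (x i) :=
        (continuous_bump _ θ).comp (by fun_prop)
      rw [integral_map hGs.aemeasurable hc.aestronglyMeasurable]
      exact integral_bump_le_of_hasGaussianLaw (hGSi i) (hGS0 i) (hGSvar i) hr θ) hA
  rw [map_measureReal_apply hXs hA.measurableSet, map_measureReal_apply hGs hA.measurableSet,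
    hD12, hD8] at key
  rw [he1, hD13, ← ht]
  rw [hD4, ht4, he2] at hΔ
  exact key.trans (smoothing_bound_le hD1 he0 ht0 hκ hΔ rfl)
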